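/- **Setting.** Let $\mathbb U=\bigcup_{n\ge0}\mathbb N^n$, $\mathbb N=\{1,2,\dots\}$, be the Ulam tree (finite words; $|\mathbf p|$ is the length of $\mathbf p$, $\mathbf p\ell$ the $\ell$-th child of $\mathbf p$), and fix $d\ge1$. A *decoration* $\mathcal D$ assigns to each $\mathbf p\in\mathbb U$ a nonempty compact metric space $(D_{\mathbf p},\mathrm d_{\mathbf p})$ with a root $\rho_{\mathbf p}$, a sequence of marked points $(x_{\mathbf p;\ell})_{\ell\ge1}$ and a finite $\mathbb R_+^d$-valued Borel measure $\vec\mu_{\mathbf p}=(\mu_{\mathbf p,1},\dots,\mu_{\mathbf p,d})$; put $\|\vec\mu_{\mathbf p}\|(D_{\mathbf p})=\sum_{j}\mu_{\mathbf p,j}(D_{\mathbf p})$. *GHP distances.* Let $X,Y$ be rooted metric spaces with Borel measures and with $k\ge 0$ marked points. Set $$d^{(k)}_{GHP}(X,Y)=\inf\Big\{d_H(f(X),g(Y))+d_P(f_\#\mu_X,g_\#\mu_Y)+d_Z(f(\rho_X),g(\rho_Y))\vee\max_{\ell\le k}d_Z(f(x_\ell),g(y_\ell))\Big\}\in[0,\infty],$$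 the infimum being over all isometric embeddings $f,g$ of $X,Y$ into a common metric space $Z$, with $d_H$ the Hausdorff and $d_P$ the Prohorov distance. (For compact $X,Y$ one may restrict to compact $Z$.) With infinitely many marks, $d^{(\infty)}_{GHP}=\sum_{k\ge1}2^{-k}(d^{(k)}_{GHP}\wedge1)$, where $d^{(k)}_{GHP}$ uses the first $k$ marks. For spaces with $\mathbb R^d_+$-valued measures, the distance is the sum over $j=1,\dots,d$ of the distances between the spaces carrying the $j$-th coordinate measures. GHP convergence (without marks: $k=0$; infinitely marked: $k=\infty$) means that this distance tends to $0$. *Gluing.* On $\bigsqcup_{\mathbf p}D_{\mathbf p}$ let $\mathrm d(z,y)=\mathrm d_{\mathbf p}(z,y)$ for $z,y\in D_{\mathbf p}$. For $z\in D_{\mathbf p}$ and $y\in D_{\mathbf q}$ with $\mathbf q=\mathbf p(r_1,\dots,r_m)$, $m\ge1$, let $$\mathrm d(z,y)=\mathrm d(y,z)=\mathrm d_{\mathbf p}(z,x_{\mathbf p;r_1})+\sum_{i=1}^{m-1}\mathrm d_{\mathbf p(r_1,\dots,r_i)}(\rho_{\mathbf p(r_1,\dots,r_i)},x_{\mathbf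 p(r_1,\dots,r_i);r_{i+1}})+\mathrm d_{\mathbf q}(\rho_{\mathbf q},y).$$ If neither of $\mathbf p,\mathbf q$ is a prefix of the other, let $\mathbf w$ be their longest common prefix, and let $\mathbf w\ell$ and $\mathbf wr$ be the prefixes of $\mathbf p$ and $\mathbf q$ of length $|\mathbf w|+1$; then $\mathrm d(z,y)=\mathrm d_{\mathbf w}(x_{\mathbf w;\ell},x_{\mathbf w;r})+\mathrm d(x_{\mathbf w;\ell},z)+\mathrm d(x_{\mathbf w;r},y)$. Points at distance $0$ are exactly those identified by the smallest equivalence relation with $x_{\mathbf p;\ell}\sim\rho_{\mathbf p\ell}$ for all $\mathbf p,\ell$. The *glued decoration* $\mathscr G(\mathcal D)$ is the Cauchy completion of the quotient $\big(\bigsqcup_{\mathbf p}D_{\mathbf p}\big)/\!\sim$, with root $\rho_\emptyset$ and the $[0,\infty]^d$-valued measure $\sum_{\mathbf p}\vec\mu_{\mathbf p}$ (sum of the images of the $\vec\mu_{\mathbf p}$). **Assumption 2.1** for $\mathcal D$: (1) $\sum_{\mathbf p}\mu_{\mathbf p,j}(D_{\mathbf p})<\infty$ for each $j\in\{1,\dots,d\}$;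 (2) for all $h\ge1$, $\varepsilon>0$ there is a finite set $I(h,\varepsilon)$ with $\operatorname{diam}(D_{\mathbf p})\le\varepsilon$ for all $\mathbf p\notin I(h,\varepsilon)$ with $|\mathbf p|=h$; (3) for all $\varepsilon>0$ there is $h$ such that for all $|\mathbf p|>h$ and $y\in D_{\mathbf p}$ there are $|\mathbf q|\le h$ and $z\in D_{\mathbf q}$ with $d_{\mathscr G(\mathcal D)}(y,z)\le\varepsilon$. **Theorem 2.2.** Let $\mathcal D^n$ ($n\ge1$) and $\mathcal D$ be decorations such that: * **(H.1)** for each $\mathbf p\in\mathbb U$, $\mathcal D^n(\mathbf p)\to\mathcal D(\mathbf p)$ in the infinitely marked GHP topology; * **(H.2)** for all $h\ge1$ and $\varepsilon>0$ there are a finite $I(h,\varepsilon)\subset\{|\mathbf p|=h\}$ and $n_{h,\varepsilon}$ such that for all $n\ge n_{h,\varepsilon}$ $$\sum_{\mathbf p\notin I(h,\varepsilon),\,|\mathbf p|=h}\|\vec\mu^n_{\mathbf p}\|(D^n_{\mathbf p})\le\varepsilon\quad\text{and}\quad\sup_{\mathbf p\notin I(h,\varepsilon),\,|\mathbf p|=h}\operatorname{diam}(D^n_{\mathbf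 p})\le\varepsilon;$$ * **(H.3)** for all $\varepsilon>0$ there are $h$ and $n_{h,\varepsilon}$ such that for all $n\ge n_{h,\varepsilon}$: $\sum_{|\mathbf p|>h}\|\vec\mu^n_{\mathbf p}\|(D^n_{\mathbf p})\le\varepsilon$, and for all $\mathbf p\in\mathbb U$ and $y\in D^n_{\mathbf p}$ there are $|\mathbf q|\le h$ and $z\in D^n_{\mathbf q}$ with $d_{\mathscr G(\mathcal D^n)}(y,z)\le\varepsilon$. Then $\mathcal D$ satisfies Assumption 2.1, $\mathscr G(\mathcal D)$ is compact with a finite measure, and $\mathscr G(\mathcal D^n)\to\mathscr G(\mathcal D)$ in the GHP topology. -/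

import Mathlib

open MeasureTheory Filter Topology
open scoped ENNReal

universe u

namespace UlamGluing

/-! ### Pointed metric measure spaces -/

/-- A pointed (rooted) metric space with a `d`-tuple of Borel measures `μ 0, …, μ (d-1)`, regarded
as one measure with values in `[0,∞]^d`. No compactness or finiteness is required here. -/
structure PMMSpace (d : ℕ) : Type (u + 1) where
  carrier : Type u
  [metric : MetricSpace carrier]
  [meas : MeasurableSpace carrier]
  [borel : BorelSpace carrier]
  root : carrier
  μ : Fin d → Measure carrier

attribute [instance] PMMSpace.metric PMMSpace.meas PMMSpace.borel

/-- A compact pointed metric measure space with infinitely many marked points and a finite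
`ℝ₊^d`-valued measure. The marks are numbered from `0`: `mark ℓ` is the mark `x_{ℓ+1}`. -/
structure MarkedSpace (d : ℕ) : Type (u + 1) extends PMMSpace.{u} d where
  mark : ℕ → carrier
  [compact : CompactSpace carrier]
  [finite : ∀ j, IsFiniteMeasure (μ j)]

attribute [instance] MarkedSpace.compact MarkedSpace.finite

/-- The total mass `‖μ‖(X)`, the sum of the masses of the `d` coordinates. -/
noncomputable def PMMSpace.totalMass {d : ℕ} (X : PMMSpace.{u} d) : ℝ≥0∞ :=
  ∑ j, X.μ j Set.univ

/-- The diameter of the space. -/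
noncomputable def PMMSpace.diam {d : ℕ} (X : PMMSpace.{u} d) : ℝ :=
  Metric.diam (Set.univ : Set X.carrier)

/-! ### Gromov-Hausdorff-Prohorov distances -/

/-- The Gromov-Hausdorff-Prohorov distance with `k` marks, for the coordinate `j` of the measures:
the infimum, over all isometric embeddings `f`, `g` of `X` and `Y` into a common metric space `Z`,
of Hausdorff distance + Prohorov distance + the maximum of the distances between the images of the
roots and of the `k` pairs of marks. -/
noncomputable def ghpCoord {d : ℕ} (X Y : PMMSpace.{u} d) (j : Fin d) {k : ℕ}
    (x : Fin k → X.carrier) (y : Fin k → Y.carrier) : ℝ≥0∞ :=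
  ⨅ (Z : Type u) (_ : MetricSpace Z) (_ : MeasurableSpace Z) (_ : BorelSpace Z)
    (f : X.carrier → Z) (g : Y.carrier → Z) (_ : Isometry f) (_ : Isometry g),
    Metric.hausdorffEDist (Set.range f) (Set.range g)
      + levyProkhorovEDist ((X.μ j).map f) ((Y.μ j).map g)
      + max (edist (f X.root) (g Y.root)) (⨆ i, edist (f (x i)) (g (y i)))

/-- The GHP distance between pointed spaces with `d`-tuples of measures: the sum over the `d`
coordinates of the GHP distances (no marks). -/
noncomputable def ghpDist {d : ℕ} (X Y : PMMSpace.{u} d) : ℝ≥0∞ :=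
  ∑ j, ghpCoord X Y j (k := 0) Fin.elim0 Fin.elim0

/-- The infinitely marked GHP distance `∑_j ∑_{k ≥ 1} 2^{-k} (d_GHP^{(k)} ∧ 1)`, where
`d_GHP^{(k)}` only sees the first `k` marks. -/
noncomputable def ghpDistMarked {d : ℕ} (X Y : MarkedSpace.{u} d) : ℝ≥0∞ :=
  ∑ j, ∑' k : ℕ, (2 : ℝ≥0∞)⁻¹ ^ (k + 1) *
    min (ghpCoord X.toPMMSpace Y.toPMMSpace j (k := k + 1)
      (fun i => X.mark i) (fun i => Y.mark i)) 1

/-! ### Decorations and gluing -/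

/-- A decoration of the Ulam tree. The vertices of the tree are the finite words `List ℕ`; the root
is the empty word, the height of `p` is `p.length`, and the children of `p` are the words
`p ++ [ℓ]`. The letter `ℓ` stands for the positive integer `ℓ + 1`, as for the marks. -/
abbrev Decoration (d : ℕ) : Type (u + 1) := List ℕ → MarkedSpace.{u} d

namespace Decoration

variable {d : ℕ}

/-- The decoration seen from the child `ℓ` of the root. -/
abbrev sub (D : Decoration.{u} d) (ℓ : ℕ) : Decoration.{u} d := fun p => D (ℓ :: p)

/-- The glued distance from the root of `D []` to the point `z` of `D p`: the sum along the ancestral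
line of `p` of the distances from the root of each space to the mark leading to the next one, and
finally to `z`. -/
noncomputable def rootDist : (D : Decoration.{u} d) → (p : List ℕ) → (D p).carrier → ℝ
  | D, [], z => dist (D []).root z
  | D, ℓ :: p, z => dist (D []).root ((D []).mark ℓ) + rootDist (D.sub ℓ) p z

/-- The glued distance between the point `z` of `D p` and the point `y` of `D q`. Common letters of
`p` and `q` are removed until the last common ancestor `w` is reached. In `D w` one travels from `z`
(or from the mark leading towards `z`) to `y` (or to the mark leading towards `y`); below `w`, the
distances to the roots of the respective children of `w` are added. -/
noncomputable def glueDist :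
    (D : Decoration.{u} d) → (p : List ℕ) → (D p).carrier → (q : List ℕ) → (D q).carrier → ℝ
  | _, [], z, [], y => dist z y
  | D, [], z, r :: q, y => dist z ((D []).mark r) + rootDist (D.sub r) q y
  | D, ℓ :: p, z, [], y => dist ((D []).mark ℓ) y + rootDist (D.sub ℓ) p z
  | D, ℓ :: p, z, r :: q, y =>
    if h : r = ℓ then glueDist (D.sub ℓ) p z q (h ▸ y)
    else dist ((D []).mark ℓ) ((D []).mark r) + rootDist (D.sub ℓ) p z + rootDist (D.sub r) q y

theorem rootDist_nonneg (D : Decoration.{u} d) (p : List ℕ) (z : (D p).carrier) :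
    0 ≤ rootDist D p z := by
  induction p generalizing D with
  | nil => exact dist_nonneg
  | cons ℓ p ih => exact add_nonneg dist_nonneg (ih (D.sub ℓ) z)

theorem glueDist_cons_self (D : Decoration.{u} d) (ℓ : ℕ) (p q : List ℕ)
    (z : (D (ℓ :: p)).carrier) (y : (D (ℓ :: q)).carrier) :
    glueDist D (ℓ :: p) z (ℓ :: q) y = glueDist (D.sub ℓ) p z q y := by
  simp [glueDist]

theorem glueDist_cons_ne (D : Decoration.{u} d) {ℓ r : ℕ} (h : r ≠ ℓ) (p q : List ℕ)
    (z : (D (ℓ :: p)).carrier) (y : (D (r :: q)).carrier) :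
    glueDist D (ℓ :: p) z (r :: q) y = dist ((D []).mark ℓ) ((D []).mark r)
      + rootDist (D.sub ℓ) p z + rootDist (D.sub r) q y := by
  simp [glueDist, h]

theorem glueDist_self (D : Decoration.{u} d) (p : List ℕ) (z : (D p).carrier) :
    glueDist D p z p z = 0 := by
  induction p generalizing D with
  | nil => exact dist_self z
  | cons ℓ p ih => rw [glueDist_cons_self]; exact ih (D.sub ℓ) z

theorem glueDist_comm (D : Decoration.{u} d) (p q : List ℕ) (z : (D p).carrier)
    (y : (D q).carrier) : glueDist D p z q y = glueDist D q y p z := by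
  induction p generalizing D q with
  | nil =>
    cases q with
    | nil => exact dist_comm z y
    | cons r q => simp only [glueDist]; rw [dist_comm]
  | cons ℓ p ih =>
    cases q with
    | nil => simp only [glueDist]; rw [dist_comm]
    | cons r q =>
      by_cases h : r = ℓ
      · subst h
        rw [glueDist_cons_self, glueDist_cons_self]
        exact ih (D.sub r) q z y
      · rw [glueDist_cons_ne D h, glueDist_cons_ne D (Ne.symm h), dist_comm]
        ring

theorem glueDist_nonneg (D : Decoration.{u} d) (p q : List ℕ) (z : (D p).carrier)
    (y : (D q).carrier) : 0 ≤ glueDist D p z q y := by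
  induction p generalizing D q with
  | nil =>
    cases q with
    | nil => exact dist_nonneg
    | cons r q => exact add_nonneg dist_nonneg (rootDist_nonneg _ _ _)
  | cons ℓ p ih =>
    cases q with
    | nil => exact add_nonneg dist_nonneg (rootDist_nonneg _ _ _)
    | cons r q =>
      by_cases h : r = ℓ
      · subst h
        rw [glueDist_cons_self]
        exact ih (D.sub r) q z y
      · rw [glueDist_cons_ne D h]
        exact add_nonneg (add_nonneg dist_nonneg (rootDist_nonneg _ _ _)) (rootDist_nonneg _ _ _)

theorem glueDist_le_rootDist (D : Decoration.{u} d) (p q : List ℕ) (z : (D p).carrier)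
    (y : (D q).carrier) : glueDist D p z q y ≤ rootDist D p z + rootDist D q y := by
  induction p generalizing D q with
  | nil =>
    cases q with
    | nil => exact dist_triangle_left z y _
    | cons r q =>
      simp only [glueDist, rootDist]
      linarith [dist_triangle_left z ((D []).mark r) (D []).root]
  | cons ℓ p ih =>
    cases q with
    | nil =>
      simp only [glueDist, rootDist]
      linarith [dist_triangle_left ((D []).mark ℓ) y (D []).root]
    | cons r q =>
      by_cases h : r = ℓ
      · subst h
        rw [glueDist_cons_self]
        have := ih (D.sub r) q z y
        simp only [rootDist]
        linarith [dist_nonneg (x := (D []).root) (y := (D []).mark r)]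
      · rw [glueDist_cons_ne D h]
        simp only [rootDist]
        linarith [dist_triangle_left ((D []).mark ℓ) ((D []).mark r) (D []).root]

theorem rootDist_le (D : Decoration.{u} d) (p q : List ℕ) (z : (D p).carrier)
    (y : (D q).carrier) : rootDist D p z ≤ glueDist D p z q y + rootDist D q y := by
  induction p generalizing D q with
  | nil =>
    cases q with
    | nil =>
      simp only [glueDist, rootDist]
      linarith [dist_triangle_right (D []).root z y]
    | cons r q =>
      simp only [glueDist, rootDist]
      linarith [dist_triangle_right (D []).root z ((D []).mark r),
        rootDist_nonneg (D.sub r) q y]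
  | cons ℓ p ih =>
    cases q with
    | nil =>
      simp only [glueDist, rootDist]
      linarith [dist_triangle_right (D []).root ((D []).mark ℓ) y]
    | cons r q =>
      by_cases h : r = ℓ
      · subst h
        rw [glueDist_cons_self]
        have := ih (D.sub r) q z y
        simp only [rootDist]
        linarith
      · rw [glueDist_cons_ne D h]
        simp only [rootDist]
        linarith [dist_triangle_right (D []).root ((D []).mark ℓ) ((D []).mark r),
          rootDist_nonneg (D.sub r) q y]

theorem glueDist_triangle (D : Decoration.{u} d) (p q s : List ℕ) (z : (D p).carrier)
    (y : (D q).carrier) (x : (D s).carrier) :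
    glueDist D p z s x ≤ glueDist D p z q y + glueDist D q y s x := by
  induction p generalizing D q s with
  | nil =>
    cases q with
    | nil =>
      cases s with
      | nil => exact dist_triangle z y x
      | cons t s =>
        simp only [glueDist]
        linarith [dist_triangle z y ((D []).mark t)]
    | cons r q =>
      cases s with
      | nil =>
        simp only [glueDist]
        linarith [dist_triangle z ((D []).mark r) x, rootDist_nonneg (D.sub r) q y]
      | cons t s =>
        by_cases h : t = r
        · subst h
          rw [glueDist_cons_self]
          simp only [glueDist]
          have := rootDist_le (D.sub t) s q x y
          rw [glueDist_comm] at this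
          linarith
        · rw [glueDist_cons_ne D h]
          simp only [glueDist]
          linarith [dist_triangle z ((D []).mark r) ((D []).mark t),
            rootDist_nonneg (D.sub r) q y]
  | cons ℓ p ih =>
    cases q with
    | nil =>
      cases s with
      | nil =>
        simp only [glueDist]
        linarith [dist_triangle ((D []).mark ℓ) y x]
      | cons t s =>
        by_cases h : t = ℓ
        · subst h
          rw [glueDist_cons_self]
          simp only [glueDist]
          have := glueDist_le_rootDist (D.sub t) p s z x
          linarith [dist_nonneg (x := (D []).mark t) (y := y),
            dist_nonneg (x := y) (y := (D []).mark t)]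
        · rw [glueDist_cons_ne D h]
          simp only [glueDist]
          linarith [dist_triangle ((D []).mark ℓ) y ((D []).mark t)]
    | cons r q =>
      cases s with
      | nil =>
        by_cases h : r = ℓ
        · subst h
          rw [glueDist_cons_self]
          simp only [glueDist]
          linarith [rootDist_le (D.sub r) p q z y]
        · rw [glueDist_cons_ne D h]
          simp only [glueDist]
          linarith [dist_triangle ((D []).mark ℓ) ((D []).mark r) x,
            rootDist_nonneg (D.sub r) q y]
      | cons t s =>
        by_cases h : r = ℓ
        · subst h
          rw [glueDist_cons_self]
          by_cases h' : t = r
          · subst h'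
            rw [glueDist_cons_self, glueDist_cons_self]
            exact ih (D.sub t) q s z y x
          · rw [glueDist_cons_ne D h', glueDist_cons_ne D h']
            linarith [rootDist_le (D.sub r) p q z y]
        · rw [glueDist_cons_ne D h]
          by_cases h' : t = r
          · subst h'
            rw [glueDist_cons_self, glueDist_cons_ne D h]
            have := rootDist_le (D.sub t) s q x y
            rw [glueDist_comm] at this
            linarith
          · rw [glueDist_cons_ne D h']
            by_cases h'' : t = ℓ
            · subst h''
              rw [glueDist_cons_self]
              have := glueDist_le_rootDist (D.sub t) p s z x
              linarith [rootDist_nonneg (D.sub r) q y,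
                dist_nonneg (x := (D []).mark t) (y := (D []).mark r),
                dist_nonneg (x := (D []).mark r) (y := (D []).mark t)]
            · rw [glueDist_cons_ne D h'']
              linarith [dist_triangle ((D []).mark ℓ) ((D []).mark r) ((D []).mark t),
                rootDist_nonneg (D.sub r) q y]

/-- The disjoint union of the spaces of the decoration. -/
def Pre (D : Decoration.{u} d) : Type u := Σ p : List ℕ, (D p).carrier

noncomputable instance (D : Decoration.{u} d) : PseudoMetricSpace D.Pre where
  dist a b := glueDist D a.1 a.2 b.1 b.2
  dist_self a := glueDist_self D a.1 a.2
  dist_comm a b := glueDist_comm D a.1 b.1 a.2 b.2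
  dist_triangle a b c := glueDist_triangle D a.1 b.1 c.1 a.2 b.2 c.2

/-- The identification of the mark `x_{p;ℓ}` of `D p` with the root of `D (pℓ)`. -/
inductive GlueRel (D : Decoration.{u} d) : D.Pre → D.Pre → Prop
  | glue (p : List ℕ) (ℓ : ℕ) : GlueRel D ⟨p, (D p).mark ℓ⟩ ⟨p ++ [ℓ], (D (p ++ [ℓ])).root⟩

/-- The glued space before completion: points of the disjoint union at glued distance zero are
identified. -/
abbrev GluedStar (D : Decoration.{u} d) : Type u := SeparationQuotient D.Pre

theorem glueDist_mark_root (D : Decoration.{u} d) (p : List ℕ) (ℓ : ℕ) :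
    glueDist D p ((D p).mark ℓ) (p ++ [ℓ]) (D (p ++ [ℓ])).root = 0 := by
  induction p generalizing D with
  | nil =>
    change dist ((D []).mark ℓ) ((D []).mark ℓ) + dist (D [ℓ]).root (D [ℓ]).root = 0
    simp
  | cons r p ih =>
    have := glueDist_cons_self D r p (p ++ [ℓ]) ((D (r :: p)).mark ℓ) (D (r :: (p ++ [ℓ]))).root
    exact this.trans (ih (D.sub r))

theorem eqvGen_cons (D : Decoration.{u} d) (ℓ : ℕ) {a b : (D.sub ℓ).Pre}
    (h : Relation.EqvGen (GlueRel (D.sub ℓ)) a b) :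
    Relation.EqvGen (GlueRel D) ⟨ℓ :: a.1, a.2⟩ ⟨ℓ :: b.1, b.2⟩ := by
  induction h with
  | rel a b h =>
    cases h with
    | glue p r => exact .rel _ _ (GlueRel.glue (D := D) (ℓ :: p) r)
  | refl a => exact .refl _
  | symm a b _ ih => exact .symm _ _ ih
  | trans a b c _ _ ih₁ ih₂ => exact .trans _ _ _ ih₁ ih₂

theorem eqvGen_of_rootDist (D : Decoration.{u} d) (p : List ℕ) (z : (D p).carrier)
    (h : rootDist D p z = 0) :
    Relation.EqvGen (GlueRel D) ⟨[], (D []).root⟩ ⟨p, z⟩ := by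
  induction p generalizing D with
  | nil =>
    have : (D []).root = z := eq_of_dist_eq_zero h
    subst this
    exact .refl _
  | cons ℓ p ih =>
    simp only [rootDist] at h
    have h₁ := rootDist_nonneg (D.sub ℓ) p z
    have h₂ := dist_nonneg (x := (D []).root) (y := (D []).mark ℓ)
    have h₃ : (D []).root = (D []).mark ℓ := eq_of_dist_eq_zero (by linarith)
    have h₄ := eqvGen_cons D ℓ (ih (D.sub ℓ) z (by linarith))
    rw [h₃]
    exact .trans _ _ _ (.rel _ _ (GlueRel.glue (D := D) [] ℓ)) h₄

theorem eqvGen_mark (D : Decoration.{u} d) (ℓ : ℕ) (p : List ℕ) (z : (D (ℓ :: p)).carrier)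
    (h : rootDist (D.sub ℓ) p z = 0) :
    Relation.EqvGen (GlueRel D) ⟨[], (D []).mark ℓ⟩ ⟨ℓ :: p, z⟩ :=
  .trans _ _ _ (.rel _ _ (GlueRel.glue (D := D) [] ℓ))
    (eqvGen_cons D ℓ (eqvGen_of_rootDist (D.sub ℓ) p z h))

theorem eqvGen_of_glueDist (D : Decoration.{u} d) (p q : List ℕ) (z : (D p).carrier)
    (y : (D q).carrier) (h : glueDist D p z q y = 0) :
    Relation.EqvGen (GlueRel D) ⟨p, z⟩ ⟨q, y⟩ := by
  induction p generalizing D q with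
  | nil =>
    cases q with
    | nil =>
      have : z = y := eq_of_dist_eq_zero h
      subst this
      exact .refl _
    | cons r q =>
      simp only [glueDist] at h
      have h₁ := rootDist_nonneg (D.sub r) q y
      have h₂ := dist_nonneg (x := z) (y := (D []).mark r)
      have h₃ : z = (D []).mark r := eq_of_dist_eq_zero (by linarith)
      rw [h₃]
      exact eqvGen_mark D r q y (by linarith)
  | cons ℓ p ih =>
    cases q with
    | nil =>
      simp only [glueDist] at h
      have h₁ := rootDist_nonneg (D.sub ℓ) p z
      have h₂ := dist_nonneg (x := (D []).mark ℓ) (y := y)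
      have h₃ : (D []).mark ℓ = y := eq_of_dist_eq_zero (by linarith)
      rw [← h₃]
      exact .symm _ _ (eqvGen_mark D ℓ p z (by linarith))
    | cons r q =>
      by_cases hr : r = ℓ
      · subst hr
        rw [glueDist_cons_self] at h
        exact eqvGen_cons D r (ih (D.sub r) q z y h)
      · rw [glueDist_cons_ne D hr] at h
        have h₁ := rootDist_nonneg (D.sub ℓ) p z
        have h₂ := rootDist_nonneg (D.sub r) q y
        have h₃ := dist_nonneg (x := (D []).mark ℓ) (y := (D []).mark r)
        have h₄ : (D []).mark ℓ = (D []).mark r := eq_of_dist_eq_zero (by linarith)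
        have h₅ := eqvGen_mark D ℓ p z (by linarith)
        rw [h₄] at h₅
        exact .trans _ _ _ (.symm _ _ h₅) (eqvGen_mark D r q y (by linarith))

/-- `GluedStar D` is the quotient of the disjoint union by the smallest equivalence relation that
identifies each mark with the root of the corresponding child. -/
theorem mk_eq_mk_iff (D : Decoration.{u} d) (a b : D.Pre) :
    (SeparationQuotient.mk a : D.GluedStar) = SeparationQuotient.mk b ↔
      Relation.EqvGen (GlueRel D) a b := by
  rw [SeparationQuotient.mk_eq_mk, Metric.inseparable_iff]
  constructor
  · exact fun h => eqvGen_of_glueDist D a.1 b.1 a.2 b.2 h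
  · intro h
    induction h with
    | rel a b h =>
      cases h with
      | glue p ℓ => exact glueDist_mark_root D p ℓ
    | refl a => exact dist_self a
    | symm a b _ ih => rw [dist_comm]; exact ih
    | trans a b c _ _ ih₁ ih₂ =>
      exact le_antisymm ((dist_triangle a b c).trans (by rw [ih₁, ih₂, add_zero])) dist_nonneg

/-- The underlying space of the glued decoration: the Cauchy completion of `GluedStar D`. -/
abbrev GluedCarrier (D : Decoration.{u} d) : Type u := UniformSpace.Completion D.GluedStar

noncomputable instance (D : Decoration.{u} d) : MeasurableSpace D.GluedCarrier := borel _

instance (D : Decoration.{u} d) : BorelSpace D.GluedCarrier := ⟨rfl⟩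

/-- The canonical map from `D p` to the glued decoration. -/
noncomputable def incl (D : Decoration.{u} d) (p : List ℕ) (z : (D p).carrier) : D.GluedCarrier :=
  ((SeparationQuotient.mk (⟨p, z⟩ : D.Pre) : D.GluedStar) : D.GluedCarrier)

theorem dist_incl (D : Decoration.{u} d) (p q : List ℕ) (z : (D p).carrier) (y : (D q).carrier) :
    dist (D.incl p z) (D.incl q y) = glueDist D p z q y := by
  simp only [incl, UniformSpace.Completion.dist_eq]
  rfl

/-- The glued decoration, rooted at the root of `D []`; its measure is the sum over the Ulam tree of
the images of the measures of the spaces `D p`. -/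
noncomputable def glued (D : Decoration.{u} d) : PMMSpace.{u} d where
  carrier := D.GluedCarrier
  root := D.incl [] (D []).root
  μ j := Measure.sum fun p => ((D p).μ j).map (D.incl p)

/-- The standing condition on a decoration: the total mass is finite, at each positive height all
but finitely many of the diameters are small, and, up to `ε`, everything is close to what is glued
up to some height `h`. -/
structure UniformBound (D : Decoration.{u} d) : Prop where
  mass : ∀ j : Fin d, ∑' p : List ℕ, (D p).μ j Set.univ < ∞
  diam : ∀ h : ℕ, 1 ≤ h → ∀ ε : ℝ, 0 < ε → ∃ I : Finset (List ℕ),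
    ∀ p, p ∉ I → p.length = h → (D p).diam ≤ ε
  height : ∀ ε : ℝ, 0 < ε → ∃ h : ℕ, ∀ p : List ℕ, h < p.length → ∀ y : (D p).carrier,
    ∃ q : List ℕ, q.length ≤ h ∧ ∃ z : (D q).carrier, dist (D.incl p y) (D.incl q z) ≤ ε

end Decoration

end UlamGluing

/-!
The proof works with correspondences instead of embeddings. For one coordinate of the measures, a
bound on the GHP distance amounts to a relation between the two spaces that has full projections,
relates roots and marks, distorts distances little and satisfies the Prohorov inequalities
(`exists_isGHPCorr`, `IsGHPCorr.ghpCoord_le`). Correspondences can be glued directly: a glued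
distance is a sum of distances between roots, marks and endpoints, one for each vertex on a path in
the tree, so relations on the spaces `D p`, for `p` in a finite subtree `T`, with small distortion
give a relation with small distortion on the union of these spaces
(`DistortionLE.abs_glueDist_sub_le`).

It remains to control what is outside `T`. The hypotheses on masses, diameters and heights together
say that for each `ε` there is one finite subtree `T` such that, for all large `n`, the mass outside
`T` is at most `ε` and everything grafted above a vertex outside `T` is within `ε` of the root of
that vertex (`TailBound`, `exists_tailBound`): a path out of `T` crosses finitely many heights with
small diameters, and beyond the last of them the closest points of the lower part are the points of
attachment. Such a bound is closed under vertex by vertex convergence (`TailBound.of_eventually`),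
hence holds for the limit decoration. Its consequences there are the standing condition
(`uniformBound_of_tailBound`) and compactness of the glued space (`compactSpace_glued`). Having it
on both sides turns the correspondence on `T` into one between the full glued spaces
(`isGHPCorr_glued`), which is the convergence.
-/

namespace UlamGluing

variable {d : ℕ}

/-! ### Correspondences between metric measure spaces -/

/-- `R` is a `δ`-correspondence between `X` and `Y` for the `j`-th measures: a relation with full
projections that relates the roots, distorts distances by at most `2 * δ`, and satisfies the
Prohorov inequalities with `R`-images instead of neighbourhoods. Such relations are an intrinsic
substitute for isometric embeddings into a common space. -/
structure IsGHPCorr (X Y : PMMSpace.{u} d) (j : Fin d) (R : X.carrier → Y.carrier → Prop)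
    (δ : ℝ) : Prop where
  left_total : ∀ x, ∃ y, R x y
  right_total : ∀ y, ∃ x, R x y
  root : R X.root Y.root
  abs_dist_sub_le : ∀ {x x' y y'}, R x y → R x' y' → |dist x x' - dist y y'| ≤ 2 * δ
  measure_le : ∀ A, MeasurableSet A → X.μ j A ≤ Y.μ j {y | ∃ x ∈ A, R x y} + ENNReal.ofReal δ
  measure_ge : ∀ B, MeasurableSet B → Y.μ j B ≤ X.μ j {x | ∃ y ∈ B, R x y} + ENNReal.ofReal δ

/-- A Prohorov inequality for `R`-images gives one for neighbourhoods of the image measures. -/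
theorem map_le_map_thickening {X Y Z : Type*} [MeasurableSpace X] [MeasurableSpace Y]
    [MetricSpace Z] [MeasurableSpace Z] [BorelSpace Z] {μ : Measure X} {ν : Measure Y}
    {f : X → Z} {g : Y → Z} (hf : Measurable f) (hg : Measurable g) {R : X → Y → Prop} {δ : ℝ}
    (hR : ∀ x y, R x y → dist (f x) (g y) ≤ δ)
    (h : ∀ A, MeasurableSet A → μ A ≤ ν {y | ∃ x ∈ A, R x y} + ENNReal.ofReal δ)
    {ε : ℝ≥0∞} (hε : ENNReal.ofReal δ < ε) (hε' : ε < ∞) {B : Set Z} (hB : MeasurableSet B) :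
    μ.map f B ≤ ν.map g (Metric.thickening ε.toReal B) + ε := by
  rw [Measure.map_apply hf hB, Measure.map_apply hg Metric.isOpen_thickening.measurableSet]
  refine (h _ (hf hB)).trans (add_le_add (measure_mono ?_) hε.le)
  rintro y ⟨x, hx, hxy⟩
  refine Metric.mem_thickening_iff.2 ⟨f x, hx, ?_⟩
  rw [dist_comm]
  exact (hR x y hxy).trans_lt ((ENNReal.ofReal_lt_iff_lt_toReal
    (dist_nonneg.trans (hR x y hxy)) hε'.ne).1 hε)

/-- A correspondence whose related points are close in a common space bounds the GHP distance. -/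
theorem IsGHPCorr.ghpCoord_le_of_isometry {X Y : PMMSpace.{u} d} {j : Fin d}
    {R : X.carrier → Y.carrier → Prop} {δ : ℝ} (h : IsGHPCorr X Y j R δ)
    {Z : Type u} [MetricSpace Z] {f : X.carrier → Z} {g : Y.carrier → Z}
    (hf : Isometry f) (hg : Isometry g) (hfg : ∀ x y, R x y → dist (f x) (g y) ≤ δ) :
    ghpCoord X Y j (k := 0) Fin.elim0 Fin.elim0 ≤ ENNReal.ofReal (3 * δ) := by
  let _ : MeasurableSpace Z := borel Z
  have _ : BorelSpace Z := ⟨rfl⟩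
  have hδ : 0 ≤ δ := dist_nonneg.trans (hfg _ _ h.root)
  have hfg' : ∀ x y, R x y → edist (f x) (g y) ≤ ENNReal.ofReal δ := fun x y hxy => by
    rw [edist_dist]
    exact ENNReal.ofReal_le_ofReal (hfg x y hxy)
  have hf' := hf.continuous.measurable
  have hg' := hg.continuous.measurable
  have h₁ : Metric.hausdorffEDist (Set.range f) (Set.range g) ≤ ENNReal.ofReal δ := by
    refine Metric.hausdorffEDist_le_of_mem_edist ?_ ?_
    · rintro _ ⟨x, rfl⟩
      obtain ⟨y, hy⟩ := h.left_total x
      exact ⟨g y, ⟨y, rfl⟩, hfg' x y hy⟩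
    · rintro _ ⟨y, rfl⟩
      obtain ⟨x, hx⟩ := h.right_total y
      exact ⟨f x, ⟨x, rfl⟩, by rw [edist_comm]; exact hfg' x y hx⟩
  have h₂ : levyProkhorovEDist ((X.μ j).map f) ((Y.μ j).map g) ≤ ENNReal.ofReal δ := by
    refine levyProkhorovEDist_le_of_forall _ _ _ fun ε B hε hε' hB => ⟨?_, ?_⟩
    · exact map_le_map_thickening hf' hg' hfg h.measure_le hε hε' hB
    · exact map_le_map_thickening hg' hf' (R := fun y x => R x y)
        (fun y x hxy => by rw [dist_comm]; exact hfg x y hxy) h.measure_ge hε hε' hB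
  have h₃ : max (edist (f X.root) (g Y.root))
      (⨆ i : Fin 0, edist (f (Fin.elim0 i)) (g (Fin.elim0 i))) ≤ ENNReal.ofReal δ :=
    max_le (hfg' _ _ h.root) (iSup_le fun i => i.elim0)
  have h₄ : ENNReal.ofReal (3 * δ)
      = ENNReal.ofReal δ + ENNReal.ofReal δ + ENNReal.ofReal δ := by
    rw [← ENNReal.ofReal_add hδ hδ, ← ENNReal.ofReal_add (by positivity) hδ]
    ring_nf
  rw [h₄]
  refine le_trans ?_ (add_le_add (add_le_add h₁ h₂) h₃)
  exact iInf_le_of_le Z <| iInf_le_of_le _ <| iInf_le_of_le _ <| iInf_le_of_le inferInstance <|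
    iInf_le_of_le f <| iInf_le_of_le g <| iInf_le_of_le hf <| iInf_le_of_le hg le_rfl

/-- The common space is the disjoint union, with related points at distance `δ`. -/
theorem IsGHPCorr.ghpCoord_le {X Y : PMMSpace.{u} d} {j : Fin d}
    {R : X.carrier → Y.carrier → Prop} {δ : ℝ} (hδ : 0 < δ) (h : IsGHPCorr X Y j R δ) :
    ghpCoord X Y j (k := 0) Fin.elim0 Fin.elim0 ≤ ENNReal.ofReal (3 * δ) := by
  let P := {a : X.carrier × Y.carrier // R a.1 a.2}
  let Φ : P → X.carrier := fun a => a.1.1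
  let Ψ : P → Y.carrier := fun a => a.1.2
  have _ : Nonempty P := ⟨⟨(X.root, Y.root), h.root⟩⟩
  let _ : MetricSpace (X.carrier ⊕ Y.carrier) :=
    Metric.glueMetricApprox Φ Ψ δ hδ fun a b => h.abs_dist_sub_le a.2 b.2
  exact h.ghpCoord_le_of_isometry (Z := X.carrier ⊕ Y.carrier) (f := Sum.inl) (g := Sum.inr)
    (Isometry.of_dist_eq fun _ _ => rfl) (Isometry.of_dist_eq fun _ _ => rfl)
    fun x y hxy => (Metric.glueDist_glued_points Φ Ψ δ ⟨(x, y), hxy⟩).le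

/-- A small Prohorov distance between the image measures pulls back to an inequality on `X` and `Y`. -/
theorem measure_le_of_levyProkhorovEDist_lt {X Y Z : Type*}
    [MetricSpace X] [CompactSpace X] [MeasurableSpace X] [BorelSpace X]
    [MetricSpace Y] [MeasurableSpace Y] [BorelSpace Y]
    [MetricSpace Z] [MeasurableSpace Z] [BorelSpace Z] {μ : Measure X} {ν : Measure Y}
    {f : X → Z} {g : Y → Z} (hf : Isometry f) (hg : Isometry g) {δ : ℝ} (hδ : 0 ≤ δ)
    (h : levyProkhorovEDist (μ.map f) (ν.map g) < ENNReal.ofReal δ)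
    {A : Set X} (hA : MeasurableSet A) :
    μ A ≤ ν {y | ∃ x ∈ A, dist (f x) (g y) < δ} + ENNReal.ofReal δ := by
  -- by compactness the embedding is closed, so it maps Borel sets to Borel sets
  have hfe : MeasurableEmbedding f := hf.isClosedEmbedding.measurableEmbedding
  have := left_measure_le_of_levyProkhorovEDist_lt h (hfe.measurableSet_image.2 hA)
  rw [Measure.map_apply hg.continuous.measurable Metric.isOpen_thickening.measurableSet,
    hfe.map_apply, hfe.injective.preimage_image, ENNReal.toReal_ofReal hδ] at this
  refine this.trans (add_le_add (measure_mono fun y hy => ?_) le_rfl)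
  obtain ⟨_, ⟨x, hx, rfl⟩, hxy⟩ := Metric.mem_thickening_iff.1 hy
  exact ⟨x, hx, by rwa [dist_comm]⟩

/-- Conversely, a small GHP distance between compact spaces produces a correspondence, which also
relates the marks. -/
theorem exists_isGHPCorr {X Y : MarkedSpace.{u} d} {j : Fin d} {k : ℕ}
    {x : Fin k → X.carrier} {y : Fin k → Y.carrier} {δ : ℝ}
    (h : ghpCoord X.toPMMSpace Y.toPMMSpace j x y < ENNReal.ofReal δ) :
    ∃ R : X.carrier → Y.carrier → Prop,
      IsGHPCorr X.toPMMSpace Y.toPMMSpace j R δ ∧ ∀ i, R (x i) (y i) := by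
  simp only [ghpCoord, iInf_lt_iff] at h
  obtain ⟨Z, _, _, _, f, g, hf, hg, h⟩ := h
  have hδ : 0 ≤ δ := (ENNReal.ofReal_pos.1 (bot_le.trans_lt h)).le
  have h₁ := (le_self_add.trans le_self_add).trans_lt h
  have h₂ := (le_add_self.trans le_self_add).trans_lt h
  have h₃ := le_add_self.trans_lt h
  have hd : ∀ {a b : Z}, edist a b < ENNReal.ofReal δ → dist a b < δ := fun {a b} hab => by
    rw [edist_dist] at hab
    exact (ENNReal.ofReal_lt_ofReal_iff_of_nonneg dist_nonneg).1 hab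
  refine ⟨fun a b => dist (f a) (g b) < δ, ⟨fun a => ?_, fun b => ?_, ?_, ?_, ?_, ?_⟩, fun i => ?_⟩
  · obtain ⟨_, ⟨b, rfl⟩, hb⟩ := Metric.exists_edist_lt_of_hausdorffEDist_lt
      (Set.mem_range_self a) h₁
    exact ⟨b, hd hb⟩
  · rw [Metric.hausdorffEDist_comm] at h₁
    obtain ⟨_, ⟨a, rfl⟩, ha⟩ := Metric.exists_edist_lt_of_hausdorffEDist_lt
      (Set.mem_range_self b) h₁
    exact ⟨a, by rw [dist_comm]; exact hd ha⟩
  · exact hd ((le_max_left _ _).trans_lt h₃)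
  · intro a a' b b' hab hab'
    rw [← hf.dist_eq, ← hg.dist_eq, abs_le]
    constructor
    · linarith [dist_triangle4 (g b) (f a) (f a') (g b'), dist_comm (f a) (g b)]
    · linarith [dist_triangle4 (f a) (g b) (g b') (f a'), dist_comm (f a') (g b')]
  · exact fun A hA => measure_le_of_levyProkhorovEDist_lt hf hg hδ h₂ hA
  · intro B hB
    rw [levyProkhorovEDist_comm] at h₂
    simpa only [dist_comm (f _)] using measure_le_of_levyProkhorovEDist_lt hg hf hδ h₂ hB
  · exact hd (((le_iSup (fun i => edist (f (x i)) (g (y i))) i).trans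
      (le_max_right _ _)).trans_lt h₃)

theorem eventually_ghpCoord_lt {X : ℕ → MarkedSpace.{u} d}
    {Y : MarkedSpace.{u} d} (h : Tendsto (fun n => ghpDistMarked (X n) Y) atTop (𝓝 0))
    (j : Fin d) (k : ℕ) {δ : ℝ≥0∞} (hδ : 0 < δ) :
    ∀ᶠ n in atTop, ghpCoord (X n).toPMMSpace Y.toPMMSpace j (k := k + 1)
      (fun i => (X n).mark i) (fun i => Y.mark i) < δ := by
  have hc : 0 < (2 : ℝ≥0∞)⁻¹ ^ (k + 1) := by
    rw [pos_iff_ne_zero]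
    exact pow_ne_zero _ (by simp)
  have hpos : 0 < (2 : ℝ≥0∞)⁻¹ ^ (k + 1) * min δ 1 :=
    ENNReal.mul_pos hc.ne' (lt_min hδ one_pos).ne'
  filter_upwards [h.eventually_lt_const hpos] with n hn
  have h₁ : (2 : ℝ≥0∞)⁻¹ ^ (k + 1) * min (ghpCoord (X n).toPMMSpace Y.toPMMSpace j (k := k + 1)
      (fun i => (X n).mark i) (fun i => Y.mark i)) 1 ≤ ghpDistMarked (X n) Y :=
    (ENNReal.le_tsum k).trans (Finset.single_le_sum (f := fun j => ∑' k : ℕ,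
      (2 : ℝ≥0∞)⁻¹ ^ (k + 1) * min (ghpCoord (X n).toPMMSpace Y.toPMMSpace j (k := k + 1)
      (fun i => (X n).mark i) (fun i => Y.mark i)) 1) (fun _ _ => zero_le) (Finset.mem_univ j))
  have h₂ := lt_of_mul_lt_mul_left' (h₁.trans_lt hn)
  rcases min_lt_iff.1 h₂ with h₃ | h₃
  · exact h₃.trans_le (min_le_left _ _)
  · exact absurd h₃ (min_le_right _ _).not_gt

namespace Decoration

/-! ### Stability of the glued distances -/

/-- A set of words closed under taking prefixes. -/
def PrefixClosed (T : Set (List ℕ)) : Prop := ∀ p s : List ℕ, p ++ s ∈ T → p ∈ T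

/-- A family of relations `R p` between `D' p` and `D p` which, for `p` in `T`, relates the roots and
the marks that point inside `T`, and distorts distances by at most `η`. -/
structure DistortionLE (D' D : Decoration.{u} d) (T : Set (List ℕ))
    (R : ∀ p, (D' p).carrier → (D p).carrier → Prop) (η : ℝ) : Prop where
  root : ∀ p ∈ T, R p (D' p).root (D p).root
  mark : ∀ p ℓ, p ++ [ℓ] ∈ T → R p ((D' p).mark ℓ) ((D p).mark ℓ)
  abs_dist_sub_le : ∀ p ∈ T, ∀ {x x' y y'}, R p x y → R p x' y' → |dist x x' - dist y y'| ≤ η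

theorem PrefixClosed.sub {T : Set (List ℕ)} (hT : PrefixClosed T) (ℓ : ℕ) :
    PrefixClosed {p | ℓ :: p ∈ T} := fun p s h => hT (ℓ :: p) s h

theorem DistortionLE.sub {D' D : Decoration.{u} d} {T : Set (List ℕ)}
    {R : ∀ p, (D' p).carrier → (D p).carrier → Prop} {η : ℝ} (h : DistortionLE D' D T R η) (ℓ : ℕ) :
    DistortionLE (D'.sub ℓ) (D.sub ℓ) {p | ℓ :: p ∈ T} (fun p => R (ℓ :: p)) η where
  root p hp := h.root (ℓ :: p) hp
  mark p r hp := h.mark (ℓ :: p) r hp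
  abs_dist_sub_le p hp := h.abs_dist_sub_le (ℓ :: p) hp

/-- The distance to the root is a sum of one distance for each prefix of `p`, each of them distorted
by at most `η`. -/
theorem DistortionLE.abs_rootDist_sub_le {D' D : Decoration.{u} d} {T : Set (List ℕ)}
    {R : ∀ p, (D' p).carrier → (D p).carrier → Prop} {η : ℝ} (h : DistortionLE D' D T R η)
    (hT : PrefixClosed T) {p : List ℕ} (hp : p ∈ T) {x : (D' p).carrier} {y : (D p).carrier}
    (hxy : R p x y) : |rootDist D' p x - rootDist D p y| ≤ η * (p.length + 1) := by
  induction p generalizing D' D T with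
  | nil => simpa [rootDist] using h.abs_dist_sub_le [] hp (h.root [] hp) hxy
  | cons ℓ p ih =>
    have h₁ := ih (h.sub ℓ) (hT.sub ℓ) hp hxy
    have h₂ := h.abs_dist_sub_le [] (hT [] _ hp) (h.root [] (hT [] _ hp))
      (h.mark [] ℓ (hT [ℓ] p hp))
    rw [abs_le] at h₁ h₂ ⊢
    simp only [rootDist, List.length_cons]
    push_cast
    constructor <;> linarith

theorem DistortionLE.abs_glueDist_sub_le {D' D : Decoration.{u} d} {T : Set (List ℕ)}
    {R : ∀ p, (D' p).carrier → (D p).carrier → Prop} {η : ℝ} (h : DistortionLE D' D T R η)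
    (hη : 0 ≤ η) (hT : PrefixClosed T) {p q : List ℕ} (hp : p ∈ T) (hq : q ∈ T)
    {x : (D' p).carrier} {y : (D p).carrier} (hxy : R p x y)
    {x' : (D' q).carrier} {y' : (D q).carrier} (hxy' : R q x' y') :
    |glueDist D' p x q x' - glueDist D p y q y'| ≤ η * (p.length + q.length + 1) := by
  have h₀ : [] ∈ T := hT [] p hp
  induction p generalizing D' D T q with
  | nil =>
    cases q with
    | nil => simpa [glueDist] using h.abs_dist_sub_le [] hp hxy hxy'
    | cons r q =>
      have h₁ := (h.sub r).abs_rootDist_sub_le (hT.sub r) hq hxy'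
      have h₂ := h.abs_dist_sub_le [] h₀ hxy (h.mark [] r (hT [r] q hq))
      rw [abs_le] at h₁ h₂ ⊢
      simp only [glueDist, List.length_cons, List.length_nil]
      push_cast
      constructor <;> linarith
  | cons ℓ p ih =>
    have h₁ := (h.sub ℓ).abs_rootDist_sub_le (hT.sub ℓ) hp hxy
    have hℓ := h.mark [] ℓ (hT [ℓ] p hp)
    cases q with
    | nil =>
      have h₂ := h.abs_dist_sub_le [] h₀ hℓ hxy'
      rw [abs_le] at h₁ h₂ ⊢
      simp only [glueDist, List.length_cons, List.length_nil]
      push_cast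
      constructor <;> linarith
    | cons r q =>
      by_cases hr : r = ℓ
      · subst hr
        rw [glueDist_cons_self, glueDist_cons_self]
        refine (ih (h.sub r) (hT.sub r) hp hq hxy hxy' (hT [r] p hp)).trans ?_
        simp only [List.length_cons]
        push_cast
        nlinarith
      · rw [glueDist_cons_ne D' hr, glueDist_cons_ne D hr]
        have h₂ := (h.sub r).abs_rootDist_sub_le (hT.sub r) hq hxy'
        have h₃ := h.abs_dist_sub_le [] h₀ hℓ (h.mark [] r (hT [r] q hq))
        rw [abs_le] at h₁ h₂ h₃ ⊢
        simp only [List.length_cons]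
        push_cast
        constructor <;> linarith

/-! ### Decorations above a given vertex -/

/-- The decoration seen from the vertex `u`. -/
abbrev subTree (D : Decoration.{u} d) (u : List ℕ) : Decoration.{u} d := fun p => D (u ++ p)

/-- All points of the decoration are at glued distance at most `c` from its root. -/
def RootRadiusLE (D : Decoration.{u} d) (c : ℝ) : Prop :=
  ∀ (s : List ℕ) (y : (D s).carrier), rootDist D s y ≤ c

theorem subTree_sub (D : Decoration.{u} d) (u : List ℕ) (ℓ : ℕ) :
    (D.subTree u).sub ℓ = D.subTree (u ++ [ℓ]) := by
  funext p
  change D (u ++ ℓ :: p) = D (u ++ [ℓ] ++ p)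
  rw [List.append_assoc, List.singleton_append]

theorem rootDist_subTree_le (D : Decoration.{u} d) (u s : List ℕ) (y : (D (u ++ s)).carrier) :
    rootDist (D.subTree u) s y ≤ rootDist D (u ++ s) y := by
  induction u generalizing D with
  | nil => exact le_rfl
  | cons ℓ u ih => exact (ih (D.sub ℓ) y).trans (le_add_of_nonneg_left dist_nonneg)

/-- A path from above `u` to a vertex that is not above `u` has to pass through the root of
`D u`. -/
theorem rootDist_subTree_le_glueDist (D : Decoration.{u} d) (u s q : List ℕ) (hq : ¬ u <+: q)
    (y : (D (u ++ s)).carrier) (z : (D q).carrier) :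
    rootDist (D.subTree u) s y ≤ glueDist D (u ++ s) y q z := by
  induction u generalizing D q with
  | nil => exact absurd List.nil_prefix hq
  | cons ℓ u ih =>
    cases q with
    | nil =>
      exact (rootDist_subTree_le (D.sub ℓ) u s y).trans (le_add_of_nonneg_left dist_nonneg)
    | cons r q =>
      by_cases hr : r = ℓ
      · subst hr
        have := glueDist_cons_self D r (u ++ s) q y z
        refine (ih (D.sub r) q (fun h => hq ?_) y z).trans this.ge
        exact List.cons_prefix_cons.2 ⟨rfl, h⟩
      · have h₁ := glueDist_cons_ne D hr (u ++ s) q y z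
        have h₂ := rootDist_subTree_le (D.sub ℓ) u s y
        have h₃ := rootDist_nonneg (D.sub r) q z
        have h₄ := dist_nonneg (x := (D []).mark ℓ) (y := (D []).mark r)
        refine le_trans ?_ h₁.ge
        refine h₂.trans ?_
        linarith

/-- What is grafted on the child `ℓ` of `w` hangs at the mark `ℓ` of `D w`. -/
theorem glueDist_mark_eq (D : Decoration.{u} d) (w : List ℕ) (ℓ : ℕ) (s : List ℕ)
    (y : (D (w ++ ℓ :: s)).carrier) :
    glueDist D (w ++ ℓ :: s) y w ((D w).mark ℓ) = rootDist ((D.subTree w).sub ℓ) s y := by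
  induction w generalizing D with
  | nil =>
    change dist ((D []).mark ℓ) ((D []).mark ℓ) + rootDist (D.sub ℓ) s y = _
    rw [dist_self, zero_add]
    rfl
  | cons r w ih =>
    exact (glueDist_cons_self D r (w ++ ℓ :: s) w y ((D (r :: w)).mark ℓ)).trans (ih (D.sub r) y)

/-- A word outside `T` leaves `T` along its prefixes. -/
theorem exists_exit {T : Set (List ℕ)} (h₀ : [] ∈ T) {p : List ℕ} (hp : p ∉ T) :
    ∃ w ℓ s, p = w ++ ℓ :: s ∧ w ∈ T ∧ w ++ [ℓ] ∉ T := by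
  induction p using List.reverseRecOn with
  | nil => exact absurd h₀ hp
  | append_singleton p ℓ ih =>
    by_cases hp' : p ∈ T
    · exact ⟨p, ℓ, [], rfl, hp', hp⟩
    · obtain ⟨w, r, s, rfl, hw, hr⟩ := ih hp'
      exact ⟨w, r, s ++ [ℓ], by simp, hw, hr⟩

theorem dist_le_diam (X : MarkedSpace.{u} d) (x y : X.carrier) : dist x y ≤ X.diam :=
  Metric.dist_le_diam_of_mem (isCompact_univ).isBounded (Set.mem_univ x) (Set.mem_univ y)

/-! ### Tails of a decoration -/

/-- Outside the set `T` of vertices, the decoration carries total mass at most `ε`, and everything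
grafted above a vertex outside `T` is within glued distance `ε` of the root of that vertex. -/
structure TailBound (D : Decoration.{u} d) (T : Finset (List ℕ)) (ε : ℝ) : Prop where
  mass : ∑' p : {p : List ℕ // p ∉ T}, (D p).totalMass ≤ ENNReal.ofReal ε
  radius : ∀ p ∉ T, (D.subTree p).RootRadiusLE ε

/-- If everything is within `ε` of the spaces of height at most `h`, then what is above a vertex `u`
of greater height is within `ε` of the root of `D u`, since the paths downwards pass through it. -/
theorem rootRadiusLE_subTree_of_height (D : Decoration.{u} d) {h : ℕ} {ε : ℝ}
    (H : ∀ (p : List ℕ) (y : (D p).carrier), ∃ q : List ℕ, q.length ≤ h ∧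
      ∃ z : (D q).carrier, dist (D.incl p y) (D.incl q z) ≤ ε) {u : List ℕ} (hu : h < u.length) :
    (D.subTree u).RootRadiusLE ε := by
  intro s y
  obtain ⟨q, hq, z, hz⟩ := H (u ++ s) y
  rw [dist_incl] at hz
  exact (D.rootDist_subTree_le_glueDist u s q (fun hp => by have := hp.length_le; omega) y z).trans
    hz

/-- Above a vertex outside `T`, a path to the root of that vertex crosses at most `k` spaces of
height at most `h` before reaching height `h + 1`. -/
theorem rootRadiusLE_subTree_of_diam (D : Decoration.{u} d) {T : Finset (List ℕ)}
    (hT : PrefixClosed (T : Set (List ℕ))) {h : ℕ} {η c : ℝ} (hη : 0 ≤ η) (hc : 0 ≤ c)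
    (hdiam : ∀ u ∉ T, u.length ≤ h → (D u).diam ≤ η)
    (hfar : ∀ u : List ℕ, h < u.length → (D.subTree u).RootRadiusLE c) (k : ℕ) {u : List ℕ}
    (hu : u ∉ T) (hk : h < u.length + k) : (D.subTree u).RootRadiusLE (k * η + c) := by
  induction k generalizing u with
  | zero => simpa using hfar u hk
  | succ k ih =>
    intro s y
    have hkη : 0 ≤ k * η := by positivity
    push_cast
    rcases lt_or_ge h u.length with hh | hh
    · linarith [hfar u hh s y]
    · have hroot : ∀ a b : (D (u ++ [])).carrier, dist a b ≤ η := fun a b =>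
        (dist_le_diam _ a b).trans (hdiam (u ++ []) (by simpa using hu) (by simpa using hh))
      cases s with
      | nil => exact (hroot _ y).trans (by linarith)
      | cons ℓ s =>
        have h₁ : ((D.subTree u).sub ℓ).RootRadiusLE (k * η + c) := by
          rw [subTree_sub]
          exact ih (fun hm => hu (hT u [ℓ] hm)) (by simp; omega)
        have h₂ := h₁ s y
        have h₃ := hroot (D (u ++ [])).root ((D (u ++ [])).mark ℓ)
        simp only [rootDist]
        linarith

theorem exists_finset_prefixClosed (I : Finset (List ℕ)) :
    ∃ T : Finset (List ℕ), PrefixClosed (T : Set (List ℕ)) ∧ [] ∈ T ∧ I ⊆ T := by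
  classical
  refine ⟨(insert [] I).biUnion fun p => p.inits.toFinset, fun p s h => ?_, ?_, fun p hp => ?_⟩
  · simp only [Finset.coe_biUnion, Set.mem_iUnion, Finset.mem_coe, List.mem_toFinset,
      List.mem_inits, exists_prop] at h ⊢
    obtain ⟨q, hq, hpq⟩ := h
    exact ⟨q, hq, (List.prefix_append p s).trans hpq⟩
  · simp
  · simp only [Finset.mem_biUnion, List.mem_toFinset, List.mem_inits]
    exact ⟨p, Finset.mem_insert_of_mem hp, List.prefix_rfl⟩

/-- The hypotheses on mass, diameters and heights amount to a tail bound outside a finite tree `T`,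
uniform for large `n`. -/
theorem exists_tailBound (D' : ℕ → Decoration.{u} d)
    (H2 : ∀ h : ℕ, 1 ≤ h → ∀ ε : ℝ, 0 < ε →
      ∃ I : Finset (List ℕ), (∀ p ∈ I, p.length = h) ∧ ∃ N : ℕ, ∀ n, N ≤ n →
        ∑' p : {p : List ℕ // p ∉ I ∧ p.length = h}, (D' n p).totalMass ≤ ENNReal.ofReal ε ∧
        ∀ p : List ℕ, p ∉ I → p.length = h → (D' n p).diam ≤ ε)
    (H3 : ∀ ε : ℝ, 0 < ε → ∃ h N : ℕ, ∀ n, N ≤ n →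
      ∑' p : {p : List ℕ // h < p.length}, (D' n p).totalMass ≤ ENNReal.ofReal ε ∧
      ∀ (p : List ℕ) (y : (D' n p).carrier), ∃ q : List ℕ, q.length ≤ h ∧
        ∃ z : (D' n q).carrier, dist ((D' n).incl p y) ((D' n).incl q z) ≤ ε)
    {ε : ℝ} (hε : 0 < ε) :
    ∃ T : Finset (List ℕ), PrefixClosed (T : Set (List ℕ)) ∧ [] ∈ T ∧
      ∀ᶠ n in atTop, (D' n).TailBound T ε := by
  classical
  obtain ⟨h, N, hN⟩ := H3 (ε / 2) (half_pos hε)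
  -- the heights from `1` to `h` cost at most `η` each, the greater ones `ε / 2` altogether
  set η : ℝ := ε / (2 * (h + 1)) with hη
  have hη₀ : 0 < η := by positivity
  have hηh : (h + 1) * η = ε / 2 := by rw [hη]; field_simp
  choose! I hI M hM using fun i (hi : 1 ≤ i) => H2 i hi η hη₀
  obtain ⟨T, hT, hT₀, hIT⟩ := exists_finset_prefixClosed ((Finset.Icc 1 h).biUnion I)
  refine ⟨T, hT, hT₀, ?_⟩
  have hIT' : ∀ p ∉ T, p.length ≤ h → p.length ∈ Finset.Icc 1 h ∧ p ∉ I p.length := by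
    intro p hp hph
    have hmem : p.length ∈ Finset.Icc 1 h := by
      refine Finset.mem_Icc.2 ⟨?_, hph⟩
      rcases p with _ | ⟨ℓ, p⟩
      · exact absurd hT₀ hp
      · simp
    exact ⟨hmem, fun hm => hp (hIT (Finset.mem_biUnion.2 ⟨_, hmem, hm⟩))⟩
  have hall : ∀ᶠ n in atTop, ∀ i ∈ Finset.Icc 1 h, M i ≤ n :=
    (Filter.eventually_all_finset _).2 fun i _ => eventually_ge_atTop (M i)
  filter_upwards [hall, eventually_ge_atTop N] with n hn hn'
  obtain ⟨hmass, hdist⟩ := hN n hn'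
  constructor
  · have hsub : {p : List ℕ | p ∉ T} ⊆ {p : List ℕ | h < p.length} ∪
        ⋃ i ∈ Finset.Icc 1 h, {p : List ℕ | p ∉ I i ∧ p.length = i} := by
      intro p hp
      rcases lt_or_ge h p.length with hh | hh
      · exact Or.inl hh
      · obtain ⟨h₁, h₂⟩ := hIT' p hp hh
        exact Or.inr (Set.mem_biUnion (x := p.length) h₁ ⟨h₂, rfl⟩)
    calc ∑' p : {p : List ℕ // p ∉ T}, (D' n p).totalMass
      _ ≤ _ := ENNReal.tsum_mono_subtype (fun p => (D' n p).totalMass) hsub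
      _ ≤ _ := ENNReal.tsum_union_le (fun p => (D' n p).totalMass) {p | h < p.length} _
      _ ≤ ENNReal.ofReal (ε / 2) + ∑ i ∈ Finset.Icc 1 h, ENNReal.ofReal η :=
        add_le_add hmass ((ENNReal.tsum_biUnion_le (fun p => (D' n p).totalMass) _
          fun i => {p : List ℕ | p ∉ I i ∧ p.length = i}).trans (Finset.sum_le_sum fun i hi =>
            (hM i (Finset.mem_Icc.1 hi).1 n (hn i hi)).1))
      _ = ENNReal.ofReal (ε / 2 + h * η) := by
        rw [Finset.sum_const, Nat.card_Icc, nsmul_eq_mul, ENNReal.ofReal_add (by positivity)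
          (by positivity), ENNReal.ofReal_mul (by positivity), ENNReal.ofReal_natCast]
        simp
      _ ≤ ENNReal.ofReal ε := ENNReal.ofReal_le_ofReal (by linarith)
  · intro u hu
    have h₁ := (D' n).rootRadiusLE_subTree_of_diam hT hη₀.le (half_pos hε).le
      (fun u hu huh => (hM _ (Finset.mem_Icc.1 (hIT' u hu huh).1).1 n
        (hn _ (hIT' u hu huh).1)).2 u (hIT' u hu huh).2 rfl)
      (fun u hu => (D' n).rootRadiusLE_subTree_of_height hdist hu) (h + 1) hu (by omega)
    intro s y
    refine (h₁ s y).trans ?_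
    push_cast
    linarith

/-! ### Passing to the limit -/

/-- Vertex by vertex convergence provides, for large `n`, simultaneous correspondences on a finite
tree that are compatible with the gluing inside the tree. -/
theorem eventually_exists_corr {D' : ℕ → Decoration.{u} d} {D : Decoration.{u} d}
    (H1 : ∀ p, Tendsto (fun n => ghpDistMarked (D' n p) (D p)) atTop (𝓝 0)) (j : Fin d)
    {T : Finset (List ℕ)} (hT : PrefixClosed (T : Set (List ℕ))) {δ : ℝ} (hδ : 0 < δ) :
    ∀ᶠ n in atTop, ∃ R : ∀ p, (D' n p).carrier → (D p).carrier → Prop,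
      (∀ p ∈ T, IsGHPCorr (D' n p).toPMMSpace (D p).toPMMSpace j (R p) δ) ∧
      DistortionLE (D' n) D T R (2 * δ) := by
  classical
  -- the letters occurring in `T` are at most `k`
  set k : ℕ := T.sup List.sum with hk
  have hall := (Filter.eventually_all_finset T).2 fun p _ =>
    eventually_ghpCoord_lt (H1 p) j k (ENNReal.ofReal_pos.2 hδ)
  filter_upwards [hall] with n hn
  have hex : ∀ p, ∃ R : (D' n p).carrier → (D p).carrier → Prop, p ∈ T →
      IsGHPCorr (D' n p).toPMMSpace (D p).toPMMSpace j R δ ∧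
      ∀ i : Fin (k + 1), R ((D' n p).mark i) ((D p).mark i) := fun p => by
    by_cases hp : p ∈ T
    · obtain ⟨R, hR⟩ := exists_isGHPCorr (hn p hp)
      exact ⟨R, fun _ => hR⟩
    · exact ⟨fun _ _ => False, fun h => absurd h hp⟩
  choose R hR using hex
  refine ⟨R, fun p hp => (hR p hp).1, fun p hp => (hR p hp).1.root, fun p ℓ hp => ?_,
    fun p hp => (hR p hp).1.abs_dist_sub_le⟩
  have h₁ : (p ++ [ℓ]).sum ≤ k := Finset.le_sup (f := List.sum) hp
  exact (hR p (hT p [ℓ] hp)).2 ⟨ℓ, by simp at h₁; omega⟩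

theorem RootRadiusLE.of_eventually {D' : ℕ → Decoration.{u} d} {D : Decoration.{u} d}
    (H1 : ∀ p, Tendsto (fun n => ghpDistMarked (D' n p) (D p)) atTop (𝓝 0)) (j : Fin d) {c : ℝ}
    (h : ∀ᶠ n in atTop, (D' n).RootRadiusLE c) : D.RootRadiusLE c := by
  classical
  intro s y
  refine le_of_forall_pos_le_add fun ε hε => ?_
  set δ : ℝ := ε / (2 * (s.length + 1)) with hδ
  have hδ₀ : 0 < δ := by positivity
  have hT : PrefixClosed (s.inits.toFinset : Set (List ℕ)) := fun p t hp => by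
    simp only [List.coe_toFinset, List.mem_inits, Set.mem_ofPred_eq] at hp ⊢
    exact (List.prefix_append p t).trans hp
  have hs : s ∈ s.inits.toFinset := by simp
  obtain ⟨n, ⟨R, hR, hD⟩, hn⟩ := ((eventually_exists_corr H1 j hT hδ₀).and h).exists
  obtain ⟨x, hx⟩ := (hR s hs).right_total y
  have h₁ := hD.abs_rootDist_sub_le hT hs hx
  have h₂ : 2 * δ * (s.length + 1) = ε := by rw [hδ]; field_simp
  rw [h₂, abs_le] at h₁
  linarith [hn s x]

theorem eventually_totalMass_le {X : ℕ → MarkedSpace.{u} d} {Y : MarkedSpace.{u} d}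
    (h : Tendsto (fun n => ghpDistMarked (X n) Y) atTop (𝓝 0)) {δ : ℝ} (hδ : 0 < δ) :
    ∀ᶠ n in atTop, Y.totalMass ≤ (X n).totalMass + d * ENNReal.ofReal δ := by
  have hall := Filter.eventually_all.2 fun j : Fin d =>
    eventually_ghpCoord_lt h j 0 (ENNReal.ofReal_pos.2 hδ)
  filter_upwards [hall] with n hn
  calc Y.totalMass ≤ ∑ j, ((X n).μ j Set.univ + ENNReal.ofReal δ) := by
        refine Finset.sum_le_sum fun j _ => ?_
        obtain ⟨R, hR, -⟩ := exists_isGHPCorr (hn j)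
        exact (hR.measure_ge _ MeasurableSet.univ).trans
          (add_le_add (measure_mono (Set.subset_univ _)) le_rfl)
    _ = _ := by simp [Finset.sum_add_distrib, PMMSpace.totalMass]

/-- Tail bounds pass to the limit; for the mass this is a form of Fatou's lemma. -/
theorem TailBound.of_eventually (hd : 1 ≤ d) {D' : ℕ → Decoration.{u} d} {D : Decoration.{u} d}
    (H1 : ∀ p, Tendsto (fun n => ghpDistMarked (D' n p) (D p)) atTop (𝓝 0))
    {T : Finset (List ℕ)} {ε : ℝ} (h : ∀ᶠ n in atTop, (D' n).TailBound T ε) :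
    D.TailBound T ε := by
  constructor
  · rw [ENNReal.tsum_eq_iSup_sum]
    refine iSup_le fun F => ENNReal.le_of_forall_pos_le_add fun η hη _ => ?_
    set δ : ℝ := η / (F.card * d + 1) with hδ
    have hδ₀ : 0 < δ := by positivity
    have hall := (Filter.eventually_all_finset F).2 fun p _ =>
      eventually_totalMass_le (H1 p.1) hδ₀
    obtain ⟨n, hn, ht⟩ := (hall.and h).exists
    calc ∑ p ∈ F, (D p.1).totalMass
      _ ≤ ∑ p ∈ F, ((D' n p.1).totalMass + d * ENNReal.ofReal δ) := Finset.sum_le_sum hn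
      _ = ∑ p ∈ F, (D' n p.1).totalMass + F.card * (d * ENNReal.ofReal δ) := by
        rw [Finset.sum_add_distrib, Finset.sum_const, nsmul_eq_mul]
      _ ≤ ENNReal.ofReal ε + η := by
        refine add_le_add ((ENNReal.sum_le_tsum F).trans ht.mass) ?_
        rw [← ENNReal.ofReal_coe_nnreal, ← ENNReal.ofReal_natCast, ← ENNReal.ofReal_natCast,
          ← ENNReal.ofReal_mul (by positivity), ← ENNReal.ofReal_mul (by positivity)]
        refine ENNReal.ofReal_le_ofReal ?_
        have : (F.card * d + 1) * δ = η := by rw [hδ]; field_simp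
        linarith
  · intro u hu
    exact RootRadiusLE.of_eventually (D' := fun n => (D' n).subTree u) (fun p => H1 (u ++ p))
      ⟨0, hd⟩ (h.mono fun n hn => hn.radius u hu)

/-! ### Consequences of the tail bounds for the glued space -/

theorem isometry_incl (D : Decoration.{u} d) (p : List ℕ) : Isometry (D.incl p) :=
  Isometry.of_dist_eq fun z y => by
    rw [dist_incl]
    induction p generalizing D with
    | nil => rfl
    | cons ℓ p ih => rw [glueDist_cons_self]; exact ih (D.sub ℓ) z y

theorem measurable_incl (D : Decoration.{u} d) (p : List ℕ) : Measurable (D.incl p) :=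
  (D.isometry_incl p).continuous.measurable

theorem TailBound.exists_dist_incl_le {D : Decoration.{u} d} {T : Finset (List ℕ)} {ε : ℝ}
    (hD : D.TailBound T ε) (hε : 0 ≤ ε) (h₀ : [] ∈ T) (p : List ℕ) (y : (D p).carrier) :
    ∃ q ∈ T, ∃ z, dist (D.incl p y) (D.incl q z) ≤ ε := by
  by_cases hp : p ∈ T
  · exact ⟨p, hp, y, by simpa using hε⟩
  · obtain ⟨w, ℓ, s, rfl, hw, hℓ⟩ := exists_exit h₀ hp
    refine ⟨w, hw, (D w).mark ℓ, ?_⟩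
    rw [dist_incl, glueDist_mark_eq]
    have h := hD.radius _ hℓ
    rw [← subTree_sub] at h
    exact h s y

theorem TailBound.exists_dist_le {D : Decoration.{u} d} {T : Finset (List ℕ)} {ε : ℝ}
    (hD : D.TailBound T ε) (hε : 0 < ε) (h₀ : [] ∈ T) (a : D.GluedCarrier) :
    ∃ q ∈ T, ∃ z, dist a (D.incl q z) ≤ 2 * ε := by
  obtain ⟨b, hb⟩ := UniformSpace.Completion.denseRange_coe.exists_dist_lt a hε
  obtain ⟨⟨p, y⟩, rfl⟩ := SeparationQuotient.surjective_mk b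
  obtain ⟨q, hq, z, hz⟩ := hD.exists_dist_incl_le hε.le h₀ p y
  refine ⟨q, hq, z, (dist_triangle a (D.incl p y) _).trans ?_⟩
  have : dist a (D.incl p y) < ε := hb
  linarith

theorem TailBound.mass_le {D : Decoration.{u} d} {T : Finset (List ℕ)} {ε : ℝ}
    (hD : D.TailBound T ε) (j : Fin d) :
    ∑' p : {p : List ℕ // p ∉ T}, (D p).μ j Set.univ ≤ ENNReal.ofReal ε :=
  (ENNReal.tsum_le_tsum fun p : {p : List ℕ // p ∉ T} => Finset.single_le_sum
    (f := fun j => (D p.1).μ j Set.univ) (fun _ _ => zero_le) (Finset.mem_univ j)).trans hD.mass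

theorem tsum_eq_sum_add_tsum_notMem {α : Type*} (T : Finset α) (f : α → ℝ≥0∞) :
    ∑' p, f p = ∑ p ∈ T, f p + ∑' p : {p // p ∉ T}, f p := by
  rw [← ENNReal.summable.tsum_add_tsum_compl (s := (T : Set α)) ENNReal.summable]
  congr 1
  exact Finset.tsum_subtype T f

theorem TailBound.tsum_mass_lt_top {D : Decoration.{u} d} {T : Finset (List ℕ)} {ε : ℝ}
    (hD : D.TailBound T ε) (j : Fin d) : ∑' p : List ℕ, (D p).μ j Set.univ < ∞ := by
  rw [tsum_eq_sum_add_tsum_notMem T]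
  exact ENNReal.add_lt_top.2 ⟨ENNReal.sum_lt_top.2 fun p _ => measure_lt_top _ _,
    (hD.mass_le j).trans_lt ENNReal.ofReal_lt_top⟩

theorem diam_le_of_rootRadiusLE {D : Decoration.{u} d} {p : List ℕ} {c : ℝ} (hc : 0 ≤ c)
    (h : (D.subTree p).RootRadiusLE c) : (D p).diam ≤ 2 * c := by
  have h' : ∀ y : (D (p ++ [])).carrier, dist (D (p ++ [])).root y ≤ c := fun y => h [] y
  rw [List.append_nil] at h'
  refine Metric.diam_le_of_forall_dist_le (by positivity) fun x _ y _ => ?_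
  linarith [dist_triangle_left x y (D p).root, h' x, h' y]

theorem uniformBound_of_tailBound {D : Decoration.{u} d}
    (h : ∀ ε : ℝ, 0 < ε → ∃ T : Finset (List ℕ), [] ∈ T ∧ D.TailBound T ε) : D.UniformBound where
  mass j := by
    obtain ⟨T, -, hT⟩ := h 1 one_pos
    exact hT.tsum_mass_lt_top j
  diam _ _ ε hε := by
    obtain ⟨T, -, hT⟩ := h (ε / 2) (half_pos hε)
    exact ⟨T, fun p hp _ => (diam_le_of_rootRadiusLE (half_pos hε).le (hT.radius p hp)).trans
      (by linarith)⟩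
  height ε hε := by
    obtain ⟨T, h₀, hT⟩ := h ε hε
    refine ⟨T.sup List.length, fun p _ y => ?_⟩
    obtain ⟨q, hq, z, hz⟩ := hT.exists_dist_incl_le hε.le h₀ p y
    exact ⟨q, Finset.le_sup (f := List.length) hq, z, hz⟩

theorem compactSpace_glued {D : Decoration.{u} d}
    (h : ∀ ε : ℝ, 0 < ε → ∃ T : Finset (List ℕ), [] ∈ T ∧ D.TailBound T ε) :
    CompactSpace D.GluedCarrier := by
  refine ⟨TotallyBounded.isCompact_of_isClosed (Metric.totallyBounded_iff.2 fun ε hε => ?_)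
    isClosed_univ⟩
  obtain ⟨T, h₀, hT⟩ := h (ε / 4) (by positivity)
  have hK : IsCompact (⋃ p ∈ T, Set.range (D.incl p)) :=
    T.isCompact_biUnion fun p _ => isCompact_range (D.isometry_incl p).continuous
  obtain ⟨t, ht, hcov⟩ := Metric.totallyBounded_iff.1 hK.totallyBounded (ε / 2) (half_pos hε)
  refine ⟨t, ht, fun a _ => ?_⟩
  obtain ⟨q, hq, z, hz⟩ := hT.exists_dist_le (by positivity) h₀ a
  obtain ⟨b, hb, hzb⟩ := Set.mem_iUnion₂.1 (hcov (Set.mem_biUnion hq (Set.mem_range_self z)))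
  rw [Metric.mem_ball] at hzb
  refine Set.mem_biUnion hb (Metric.mem_ball.2 ?_)
  linarith [dist_triangle a (D.incl q z) b]

theorem glued_μ_apply (D : Decoration.{u} d) (j : Fin d) {A : Set D.GluedCarrier}
    (hA : MeasurableSet A) : D.glued.μ j A = ∑' p, (D p).μ j (D.incl p ⁻¹' A) := by
  change (Measure.sum fun p => ((D p).μ j).map (D.incl p)) A = _
  rw [Measure.sum_apply _ hA]
  exact tsum_congr fun p => Measure.map_apply (D.measurable_incl p) hA

theorem sum_preimage_le_glued_μ (D : Decoration.{u} d) (j : Fin d) (T : Finset (List ℕ))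
    (A : Set D.GluedCarrier) : ∑ p ∈ T, (D p).μ j (D.incl p ⁻¹' A) ≤ D.glued.μ j A :=
  ((Finset.sum_le_sum fun p _ => Measure.le_map_apply (D.measurable_incl p).aemeasurable A).trans
    (ENNReal.sum_le_tsum T)).trans (Measure.le_sum_apply _ A)

theorem isFiniteMeasure_glued_μ {D : Decoration.{u} d} {j : Fin d}
    (h : ∑' p : List ℕ, (D p).μ j Set.univ < ∞) : IsFiniteMeasure (D.glued.μ j) :=
  ⟨by
    have := D.glued_μ_apply j MeasurableSet.univ
    simp only [Set.preimage_univ] at this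
    exact this.trans_lt h⟩

/-! ### Gluing correspondences -/

/-- Prohorov inequalities on the spaces indexed by `T` add up to one for the glued measures, since
the mass outside `T` is small. -/
theorem TailBound.glued_μ_le {D' D : Decoration.{u} d} {T : Finset (List ℕ)} {ε : ℝ}
    (hD' : D'.TailBound T ε) {j : Fin d} {R : ∀ p, (D' p).carrier → (D p).carrier → Prop} {δ : ℝ}
    (hR : ∀ p ∈ T, ∀ A, MeasurableSet A →
      (D' p).μ j A ≤ (D p).μ j {y | ∃ x ∈ A, R p x y} + ENNReal.ofReal δ)
    {A : Set D'.GluedCarrier} (hA : MeasurableSet A) {B : Set D.GluedCarrier}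
    (hB : ∀ p ∈ T, ∀ x y, R p x y → D'.incl p x ∈ A → D.incl p y ∈ B) :
    D'.glued.μ j A ≤ D.glued.μ j B + (T.card * ENNReal.ofReal δ + ENNReal.ofReal ε) := by
  rw [glued_μ_apply D' j hA, tsum_eq_sum_add_tsum_notMem T, ← add_assoc]
  refine add_le_add ?_ ((ENNReal.tsum_le_tsum fun p => measure_mono (Set.subset_univ _)).trans
    (hD'.mass_le j))
  calc ∑ p ∈ T, (D' p).μ j (D'.incl p ⁻¹' A)
    _ ≤ ∑ p ∈ T, ((D p).μ j (D.incl p ⁻¹' B) + ENNReal.ofReal δ) := by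
      refine Finset.sum_le_sum fun p hp => (hR p hp _ (D'.measurable_incl p hA)).trans ?_
      refine add_le_add (measure_mono ?_) le_rfl
      rintro y ⟨x, hx, hxy⟩
      exact hB p hp x y hxy hx
    _ = ∑ p ∈ T, (D p).μ j (D.incl p ⁻¹' B) + T.card * ENNReal.ofReal δ := by
      rw [Finset.sum_add_distrib, Finset.sum_const, nsmul_eq_mul]
    _ ≤ _ := add_le_add (D.sum_preimage_le_glued_μ j T B) le_rfl

/-- Two points of the glued spaces are related if they are within `ε` of points of `D' p` and `D p`
that are related by `R p`, for some `p` in `T`. -/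
def GluedRel (D' D : Decoration.{u} d) (T : Finset (List ℕ))
    (R : ∀ p, (D' p).carrier → (D p).carrier → Prop) (ε : ℝ) (a : D'.GluedCarrier)
    (b : D.GluedCarrier) : Prop :=
  ∃ p ∈ T, ∃ x y, R p x y ∧ dist a (D'.incl p x) ≤ ε ∧ dist b (D.incl p y) ≤ ε

theorem abs_dist_sub_dist_le {X Y : Type*} [PseudoMetricSpace X] [PseudoMetricSpace Y]
    {a a' x x' : X} {b b' y y' : Y} {r c : ℝ} (hax : dist a x ≤ r) (hax' : dist a' x' ≤ r)
    (hby : dist b y ≤ r) (hby' : dist b' y' ≤ r) (h : |dist x x' - dist y y'| ≤ c) :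
    |dist a a' - dist b b'| ≤ c + 4 * r := by
  have h₁ := dist_dist_dist_le a a' x x'
  have h₂ := dist_dist_dist_le b b' y y'
  rw [Real.dist_eq, abs_le] at h₁ h₂
  rw [abs_le] at h ⊢
  constructor <;> linarith

/-- Correspondences on a finite tree `T` glue to a correspondence between the glued spaces, when the
parts outside `T` are small. -/
theorem isGHPCorr_glued {D' D : Decoration.{u} d} {j : Fin d} {T : Finset (List ℕ)}
    (hT : PrefixClosed (T : Set (List ℕ))) (h₀ : [] ∈ T) {ε : ℝ} (hε : 0 < ε)
    (hD' : D'.TailBound T ε) (hD : D.TailBound T ε)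
    {R : ∀ p, (D' p).carrier → (D p).carrier → Prop} {δ : ℝ} (hδ : 0 ≤ δ)
    (hR : ∀ p ∈ T, IsGHPCorr (D' p).toPMMSpace (D p).toPMMSpace j (R p) δ)
    (hdist : DistortionLE D' D T R (2 * δ)) {L : ℕ} (hL : ∀ p ∈ T, p.length ≤ L)
    (h₁ : 2 * δ * (2 * L + 1) ≤ ε) (h₂ : T.card * δ ≤ ε) :
    IsGHPCorr D'.glued D.glued j (GluedRel D' D T R (2 * ε)) (5 * ε) := by
  have hself : ∀ {X : Type u} [MetricSpace X] (x : X), dist x x ≤ 2 * ε := fun x => by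
    rw [dist_self]; positivity
  have hmass : T.card * ENNReal.ofReal δ + ENNReal.ofReal ε ≤ ENNReal.ofReal (5 * ε) := by
    rw [← ENNReal.ofReal_natCast, ← ENNReal.ofReal_mul (by positivity),
      ← ENNReal.ofReal_add (by positivity) hε.le]
    exact ENNReal.ofReal_le_ofReal (by linarith)
  refine ⟨fun a => ?_, fun b => ?_, ?_, ?_, fun A hA => ?_, fun B hB => ?_⟩
  · obtain ⟨p, hp, x, hx⟩ := hD'.exists_dist_le hε h₀ a
    obtain ⟨y, hy⟩ := (hR p hp).left_total x
    exact ⟨D.incl p y, p, hp, x, y, hy, hx, hself _⟩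
  · obtain ⟨p, hp, y, hy⟩ := hD.exists_dist_le hε h₀ b
    obtain ⟨x, hx⟩ := (hR p hp).right_total y
    exact ⟨D'.incl p x, p, hp, x, y, hx, hself _, hy⟩
  · exact ⟨[], h₀, _, _, (hR [] h₀).root, hself _, hself _⟩
  · rintro a a' b b' ⟨p, hp, x, y, hxy, hax, hby⟩ ⟨q, hq, x', y', hxy', hax', hby'⟩
    have h₃ := hdist.abs_glueDist_sub_le (by positivity) hT hp hq hxy hxy'
    rw [← dist_incl, ← dist_incl] at h₃
    have h₄ : 2 * δ * (p.length + q.length + 1) ≤ ε := by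
      refine le_trans (mul_le_mul_of_nonneg_left ?_ (by positivity)) h₁
      have hp' : (p.length : ℝ) ≤ L := by exact_mod_cast hL p hp
      have hq' : (q.length : ℝ) ≤ L := by exact_mod_cast hL q hq
      linarith
    have h₅ := abs_dist_sub_dist_le hax hax' hby hby' (h₃.trans h₄)
    exact le_trans (b := ε + 4 * (2 * ε)) h₅ (by linarith)
  · refine (hD'.glued_μ_le (B := {b | ∃ a ∈ A, GluedRel D' D T R (2 * ε) a b})
      (fun p hp => (hR p hp).measure_le) hA fun p hp x y hxy hx => ?_).trans
      (add_le_add le_rfl hmass)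
    exact ⟨_, hx, p, hp, x, y, hxy, hself _, hself _⟩
  · refine (hD.glued_μ_le (B := {a | ∃ b ∈ B, GluedRel D' D T R (2 * ε) a b})
      (R := fun p y x => R p x y) (fun p hp => (hR p hp).measure_ge) hB
      fun p hp y x hxy hy => ?_).trans (add_le_add le_rfl hmass)
    exact ⟨_, hy, p, hp, x, y, hxy, hself _, hself _⟩

/-- If the decorations converge vertex by vertex and share a tail bound `ε` outside a finite tree,
the glued spaces are eventually within a constant multiple of `ε`. -/
theorem eventually_ghpCoord_glued_le {D' : ℕ → Decoration.{u} d} {D : Decoration.{u} d}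
    (H1 : ∀ p, Tendsto (fun n => ghpDistMarked (D' n p) (D p)) atTop (𝓝 0)) (j : Fin d)
    {T : Finset (List ℕ)} (hT : PrefixClosed (T : Set (List ℕ))) (h₀ : [] ∈ T) {ε : ℝ}
    (hε : 0 < ε) (hD' : ∀ᶠ n in atTop, (D' n).TailBound T ε) (hD : D.TailBound T ε) :
    ∀ᶠ n in atTop, ghpCoord (D' n).glued D.glued j (k := 0) Fin.elim0 Fin.elim0
      ≤ ENNReal.ofReal (15 * ε) := by
  set L : ℕ := T.sup List.length
  -- paths in `T` have at most `2 * L + 1` steps, each distorted by at most `2 * δ`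
  set δ : ℝ := ε / (2 * (2 * L + 1) + T.card) with hδ
  have hδ₀ : 0 < δ := by positivity
  have hδε : (2 * (2 * L + 1) + T.card) * δ = ε := by rw [hδ]; field_simp
  have h₁ : 0 ≤ (2 * (2 * L + 1)) * δ := by positivity
  have h₂ : 0 ≤ T.card * δ := by positivity
  filter_upwards [eventually_exists_corr H1 j hT hδ₀, hD'] with n ⟨R, hR, hdist⟩ hn
  have h := isGHPCorr_glued hT h₀ hε hn hD hδ₀.le hR hdist
    (fun p hp => Finset.le_sup (f := List.length) hp) (by linarith) (by linarith)
  refine (h.ghpCoord_le (by positivity)).trans_eq ?_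
  ring_nf

end Decoration

end UlamGluing

theorem theorem2p2 {d : ℕ} (hd : 1 ≤ d)
    (D' : ℕ → UlamGluing.Decoration.{u} d) (D : UlamGluing.Decoration.{u} d)
    -- subdecoration-wise convergence in the infinitely marked GHP distance
    (H1 : ∀ p : List ℕ,
      Tendsto (fun n => UlamGluing.ghpDistMarked (D' n p) (D p)) atTop (𝓝 0))
    -- at each height, mass and diameter are small outside a finite set, uniformly for large `n`
    (H2 : ∀ h : ℕ, 1 ≤ h → ∀ ε : ℝ, 0 < ε →
      ∃ I : Finset (List ℕ), (∀ p ∈ I, p.length = h) ∧ ∃ N : ℕ, ∀ n, N ≤ n →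
        ∑' p : {p : List ℕ // p ∉ I ∧ p.length = h}, (D' n p).totalMass ≤ ENNReal.ofReal ε ∧
        ∀ p : List ℕ, p ∉ I → p.length = h → (D' n p).diam ≤ ε)
    -- mass and distance beyond some height are small, uniformly for large `n`
    (H3 : ∀ ε : ℝ, 0 < ε → ∃ h N : ℕ, ∀ n, N ≤ n →
      ∑' p : {p : List ℕ // h < p.length}, (D' n p).totalMass ≤ ENNReal.ofReal ε ∧
      ∀ (p : List ℕ) (y : (D' n p).carrier), ∃ q : List ℕ, q.length ≤ h ∧
        ∃ z : (D' n q).carrier, dist ((D' n).incl p y) ((D' n).incl q z) ≤ ε) :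
    D.UniformBound ∧
    (CompactSpace D.glued.carrier ∧ ∀ j, IsFiniteMeasure (D.glued.μ j)) ∧
    Tendsto (fun n => UlamGluing.ghpDist (D' n).glued D.glued) atTop (𝓝 0) := by
  have hT := fun (ε : ℝ) (hε : 0 < ε) =>
    UlamGluing.Decoration.exists_tailBound D' H2 H3 hε
  have htail : ∀ ε : ℝ, 0 < ε → ∃ T : Finset (List ℕ), [] ∈ T ∧ D.TailBound T ε := fun ε hε => by
    obtain ⟨T, -, h₀, h⟩ := hT ε hε
    exact ⟨T, h₀, .of_eventually hd H1 h⟩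
  have hU := UlamGluing.Decoration.uniformBound_of_tailBound htail
  refine ⟨hU, ⟨UlamGluing.Decoration.compactSpace_glued htail,
    fun j => UlamGluing.Decoration.isFiniteMeasure_glued_μ (hU.mass j)⟩, ?_⟩
  have hj : ∀ j, Tendsto (fun n => UlamGluing.ghpCoord (D' n).glued D.glued j (k := 0)
      Fin.elim0 Fin.elim0) atTop (𝓝 0) := fun j => by
    refine ENNReal.tendsto_nhds_zero.2 fun η hη => ?_
    obtain ⟨ε, hε, hεη⟩ : ∃ ε : ℝ, 0 < ε ∧ ENNReal.ofReal (15 * ε) ≤ η := by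
      obtain ⟨r, hr, hrη⟩ := ENNReal.lt_iff_exists_nnreal_btwn.1 hη
      refine ⟨r / 15, by have : 0 < r := by exact_mod_cast hr
                         positivity, ?_⟩
      rw [mul_div_cancel₀ _ (by norm_num), ENNReal.ofReal_coe_nnreal]
      exact hrη.le
    obtain ⟨T, hpre, h₀, h⟩ := hT ε hε
    exact (UlamGluing.Decoration.eventually_ghpCoord_glued_le H1 j hpre h₀ hε h
      (.of_eventually hd H1 h)).mono fun n hn => hn.trans hεη
  simpa [UlamGluing.ghpDist] using tendsto_finsetSum Finset.univ fun j _ => hj j
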